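/- All differential fields are ordinary (one derivation) and of characteristic $0$; $C_{\mathcal G}$ denotes the field of constants of a differential field $\mathcal G$, and $\mathcal F\{Y\}$ the ring of differential polynomials in one differential indeterminate over a differential field $\mathcal F$. Definitions. Let $\mathcal F$ be a differential field, and let $\eta$, $\eta'$ be elements of (possibly different) differential field extensions of $\mathcal F$. Then $\eta'$ is a differential specialization of $\eta$ over $\mathcal F$ if $P(\eta')=0$ for every $P\in\mathcal F\{Y\}$ with $P(\eta)=0$; it is generic if $\eta$ is also a differential specialization of $\eta'$ over $\mathcal F$. The element $\eta$ is constrained over $\mathcal F$ if there is $C\in\mathcal F\{Y\}$ with $C(\eta)\neq 0$ and $C(\eta')=0$ for every non-generic differential specialization $\eta'$ of $\eta$ over $\mathcal F$. A differential field extension $\mathcal G\supset\mathcal F$ is constrained if every element of $\mathcal G$ is constrained over $\mathcal F$, and a differential field is constrainedly closed if it has no proper constrained extension. A pair $(\mathcal F,K)$ of differential fields, with $K$ a differential subfield of $\mathcal F$, is of real type if $K$ is formally real and $\mathcal F=K(i)$, where $i$ is a root of $X^2+1$. A differential extension of real type of such a pair $(\mathcal F,K)$ is a pair $(\mathcal G,L)$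 of differential fields of real type such that $\mathcal G$ is a differential field extension of $\mathcal F$ and $K=L\cap\mathcal F$. Theorem. Let $(\mathcal F,K)$ be a pair of differential fields of real type and let $(\mathcal G,L)$ be a differential extension of real type of $(\mathcal F,K)$ such that $\mathcal G$ is constrainedly closed and is a constrained extension of $\mathcal F$. Let $\mathcal L(Y)\in\mathcal F\{Y\}$ be a homogeneous linear differential polynomial of order $n$, i.e. $\mathcal L(Y)=a_nY^{(n)}+\dots+a_1Y'+a_0Y$ with $a_0,\dots,a_n\in\mathcal F$ and $a_n\neq 0$. Then there exist $y_1,\dots,y_n\in\mathcal G$ with $\mathcal L(y_j)=0$ for $j=1,\dots,n$ that are linearly independent over $C_{\mathcal G}$. -/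

import Mathlib

universe u v

namespace DiffField

/-- The field of constants `C_G` of a differential field `G`. -/
def constants (G : Type u) [Field G] [Differential G] : Subfield G where
  carrier := {x | Differential.deriv x = 0}
  mul_mem' {a b} ha hb := by
    simp only [Set.mem_ofPred_eq] at ha hb ⊢
    simp [Derivation.leibniz, ha, hb]
  one_mem' := by simp
  add_mem' {a b} ha hb := by
    simp only [Set.mem_ofPred_eq] at ha hb ⊢
    simp [ha, hb]
  zero_mem' := by simp
  neg_mem' {a} ha := by
    simp only [Set.mem_ofPred_eq] at ha ⊢
    simp [ha]
  inv_mem' a ha := by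
    simp only [Set.mem_ofPred_eq] at ha ⊢
    simp [Derivation.leibniz_inv, ha]

/-- The ring `F{Y}` of ordinary differential polynomials in one differential indeterminate:
the variable `MvPolynomial.X k` stands for the `k`-th derivative of `Y`. -/
abbrev DiffPoly (F : Type u) [Field F] : Type u := MvPolynomial ℕ F

namespace DiffPoly

/-- The value `P(η)` of `P ∈ F{Y}` at an element `η` of a differential extension of `F`:
the `k`-th derivative of `η` is substituted for the `k`-th derivative of `Y`. -/
noncomputable def eval {F : Type u} [Field F] {E : Type v} [Field E] [Differential E] [Algebra F E]
    (η : E) (P : DiffPoly F) : E :=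
  MvPolynomial.aeval (fun k : ℕ => Differential.deriv^[k] η) P

/-- `P` has order `n`: the `n`-th derivative of `Y` occurs in `P`, and no higher one does. -/
def HasOrder {F : Type u} [Field F] (P : DiffPoly F) (n : ℕ) : Prop :=
  IsGreatest {k : ℕ | k ∈ P.vars} n

/-- `P` is homogeneous linear, that is, homogeneous of degree one in the derivatives of `Y`. -/
def IsHomogeneousLinear {F : Type u} [Field F] (P : DiffPoly F) : Prop :=
  MvPolynomial.IsHomogeneous P 1

end DiffPoly

/-- `η'` is a differential specialization of `η` over `F`: every differential polynomial over `F`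
that vanishes at `η` vanishes at `η'`. The elements may lie in different extensions of `F`. -/
def IsSpecialization (F : Type u) [Field F]
    {E : Type*} [Field E] [Differential E] [Algebra F E]
    {E' : Type*} [Field E'] [Differential E'] [Algebra F E'] (η : E) (η' : E') : Prop :=
  ∀ P : DiffPoly F, P.eval η = 0 → P.eval η' = 0

/-- The differential specialization `η'` of `η` over `F` is generic: conversely, `η` is a
differential specialization of `η'` over `F`. -/
def IsGenericSpecialization (F : Type u) [Field F]
    {E : Type*} [Field E] [Differential E] [Algebra F E]
    {E' : Type*} [Field E'] [Differential E'] [Algebra F E'] (η : E) (η' : E') : Prop :=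
  IsSpecialization F η η' ∧ IsSpecialization F η' η

/-- `η` is constrained over `F`: some `C ∈ F{Y}` with `C(η) ≠ 0` vanishes at every non-generic
differential specialization of `η` over `F`, in any differential field extension `E'` of `F`.
(For infinite `F`, the extension generated over `F` by a specialization has the cardinality of
`F`, so that it is enough to let `E'` range over the universe of `F`.) -/
def IsConstrained (F : Type u) [Field F] [Differential F]
    {E : Type v} [Field E] [Differential E] [Algebra F E] (η : E) : Prop :=
  ∃ C : DiffPoly F, C.eval η ≠ 0 ∧
    ∀ (E' : Type u) [Field E'] [Differential E'] [Algebra F E'] [DifferentialAlgebra F E']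
      (η' : E'), IsSpecialization F η η' → ¬ IsGenericSpecialization F η η' → C.eval η' = 0

/-- The differential field extension `G` of `F` is constrained: each of its elements is constrained
over `F`. -/
def IsConstrainedExtension (F : Type u) [Field F] [Differential F]
    (G : Type v) [Field G] [Differential G] [Algebra F G] : Prop :=
  ∀ η : G, IsConstrained F η

/-- `G` is constrainedly closed: it has no proper constrained differential field extension. -/
def IsConstrainedlyClosed (G : Type u) [Field G] [Differential G] : Prop :=
  ∀ (H : Type u) [Field H] [Differential H] [Algebra G H] [DifferentialAlgebra G H],
    IsConstrainedExtension G H → Function.Surjective (algebraMap G H)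

/-- The pair `(F, K)` of differential fields is of real type: `K` is a differential subfield of `F`,
`K` is formally real, and `F = K(i)` for a root `i` of `X ^ 2 + 1`. -/
structure IsRealType {F : Type u} [Field F] [Differential F] (K : Subfield F) : Prop where
  deriv_mem : ∀ x ∈ K, Differential.deriv x ∈ K
  formallyReal : IsFormallyReal K
  adjoin_i : ∃ i : F, i ^ 2 + 1 = 0 ∧ IntermediateField.adjoin K {i} = ⊤

/-- For a pair `(F, K)` of real type and a differential field extension `G` of `F`, the pair `(G, L)`
is a differential extension of real type of `(F, K)`: `(G, L)` is of real type and `K = L ∩ F`. -/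
structure IsRealTypeExtension {F : Type u} [Field F] [Differential F] (K : Subfield F)
    {G : Type v} [Field G] [Differential G] [Algebra F G] [DifferentialAlgebra F G]
    (L : Subfield G) : Prop where
  realType : IsRealType L
  inter : K = L.comap (algebraMap F G)

end DiffField

/-! Adjoin a generic fundamental matrix: the polynomial ring over `G` in the entries of a square
matrix, with the companion system as derivation. Among its differential ideals containing no power
of the determinant, a maximal one is prime; the fraction field `H` of the quotient contains an
invertible solution matrix. If `H` is constrained over `G`, then `H = G` by closedness and the
matrix has entries in `G`; its first row is the required system, by the Wronskian argument.

For constrainedness, put `η` in `H` into a differentially simple subalgebra `S` of finite type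
(`isConstrainedExtension_of_maximal`). A Chevalley-type lemma
(`Algebra.FiniteType.exists_map_ne_top`) gives `c ≠ 0` in the subalgebra generated by `η` and its
derivatives such that primes avoiding `c` stay proper in `S`. A specialization where `c` does not
vanish defines such a prime; its extension is a proper differential ideal, hence zero, so the
specialization is generic. -/

/-! ### Primes that stay proper in an extension of finite type -/

theorem MvPolynomial.isPrime_map_C {R σ : Type*} [CommRing R] (P : Ideal R) [P.IsPrime] :
    (P.map (MvPolynomial.C : R →+* MvPolynomial σ R)).IsPrime := by
  rw [← Ideal.Quotient.isDomain_iff_prime]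
  exact (MvPolynomial.quotientEquivQuotientMvPolynomial (σ := σ) P).symm.toMulEquiv.isDomain

/-- An algebraic extension of finite type has an element of the base outside of which every prime
ideal extends to a proper ideal. -/
theorem Algebra.IsAlgebraic.exists_map_ne_top {T S : Type*} [CommRing T] [CommRing S]
    [IsDomain T] [Algebra T S] [FaithfulSMul T S] [Algebra.IsAlgebraic T S]
    (s : Finset S) (hs : Algebra.adjoin T (s : Set S) = ⊤) :
    ∃ a : T, a ≠ 0 ∧ ∀ q : Ideal T, q.IsPrime → a ∉ q → q.map (algebraMap T S) ≠ ⊤ := by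
  -- `a` clears the denominators of the generators, so `S` is integral over `T` up to powers of `a`.
  obtain ⟨a, ha, hint⟩ := Algebra.IsAlgebraic.exists_integral_multiples (R := T) (A := S) s
  refine ⟨a, ha, fun q hq haq htop => haq ?_⟩
  let B := integralClosure T S
  have hB : ∀ x : S, ∃ N : ℕ, a ^ N • x ∈ B := by
    intro x
    have hx : x ∈ Algebra.adjoin T (s : Set S) := by rw [hs]; trivial
    induction hx using Algebra.adjoin_induction with
    | mem x hx => exact ⟨1, by rw [pow_one]; exact hint x hx⟩
    | algebraMap r => exact ⟨0, by simp⟩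
    | add x y _ _ hx hy =>
      obtain ⟨N, hN⟩ := hx
      obtain ⟨M, hM⟩ := hy
      refine ⟨N + M, ?_⟩
      have h : a ^ (N + M) • (x + y) = a ^ M • (a ^ N • x) + a ^ N • (a ^ M • y) := by
        simp only [smul_smul, smul_add, ← pow_add, add_comm]
      rw [h]
      exact B.add_mem (B.smul_mem hN _) (B.smul_mem hM _)
    | mul x y _ _ hx hy =>
      obtain ⟨N, hN⟩ := hx
      obtain ⟨M, hM⟩ := hy
      refine ⟨N + M, ?_⟩
      have h : a ^ (N + M) • (x * y) = (a ^ N • x) * (a ^ M • y) := by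
        rw [smul_mul_smul_comm, ← pow_add]
      rw [h]
      exact B.mul_mem hN hM
  have key : ∀ x ∈ q.map (algebraMap T S), ∃ N : ℕ, ∃ b ∈ q.map (algebraMap T B),
      a ^ N • x = (b : S) := by
    intro x hx
    induction hx using Submodule.span_induction with
    | mem x hx =>
      obtain ⟨r, hr, rfl⟩ := hx
      exact ⟨0, algebraMap T B r, Ideal.mem_map_of_mem _ hr, by simp⟩
    | zero => exact ⟨0, 0, zero_mem _, by simp⟩
    | add x y _ _ hx hy =>
      obtain ⟨N, b, hb, hN⟩ := hx
      obtain ⟨M, c, hc, hM⟩ := hy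
      refine ⟨N + M, a ^ M • b + a ^ N • c,
        add_mem (Submodule.smul_of_tower_mem _ _ hb) (Submodule.smul_of_tower_mem _ _ hc), ?_⟩
      have h : a ^ (N + M) • (x + y) = a ^ M • (a ^ N • x) + a ^ N • (a ^ M • y) := by
        simp only [smul_smul, smul_add, ← pow_add, add_comm]
      rw [h, hN, hM]
      rfl
    | smul z x _ hx =>
      obtain ⟨N, b, hb, hN⟩ := hx
      obtain ⟨M, hM⟩ := hB z
      refine ⟨M + N, ⟨_, hM⟩ * b, Ideal.mul_mem_left _ _ hb, ?_⟩
      rw [smul_eq_mul, pow_add, ← smul_mul_smul_comm, hN]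
      rfl
  obtain ⟨N, b, hb, hN⟩ := key 1 (by rw [htop]; trivial)
  -- Lying over for the integral closure: from `1 ∈ qS` a power of `a` lies in `Q`, hence in `q`.
  obtain ⟨Q, -, hQ, hQq⟩ := Ideal.exists_ideal_over_prime_of_isIntegral (S := B) q ⊥ (by
    intro x hx
    have hx' : algebraMap T B x = 0 := hx
    have : x = 0 := FaithfulSMul.algebraMap_injective T S
      ((congrArg Subtype.val hx').trans (map_zero _).symm)
    simp [this])
  have hb' : b ∈ Q := Ideal.map_le_iff_le_comap.2 hQq.ge hb
  have hab : algebraMap T B (a ^ N) = b := by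
    apply Subtype.ext
    rw [← hN, Algebra.smul_def, mul_one]
    rfl
  refine hq.mem_of_pow_mem N ?_
  rw [← hQq, Ideal.mem_comap, hab]
  exact hb'

/-- For an extension `A ⊆ S` of finite type of domains, all prime ideals of `A` in some nonempty
open set extend to proper ideals of `S`. -/
theorem Algebra.FiniteType.exists_map_ne_top (A S : Type*) [CommRing A] [CommRing S]
    [IsDomain A] [IsDomain S] [Algebra A S] [FaithfulSMul A S] [Algebra.FiniteType A S] :
    ∃ c : A, c ≠ 0 ∧ ∀ q : Ideal A, q.IsPrime → c ∉ q → q.map (algebraMap A S) ≠ ⊤ := by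
  obtain ⟨s, hs⟩ := ‹Algebra.FiniteType A S›.out
  obtain ⟨ι, x, hx⟩ := exists_isTranscendenceBasis' A S
  have halg := hx.isAlgebraic
  have hT : IsScalarTower A (Algebra.adjoin A (Set.range x)) S := inferInstance
  have hF : FaithfulSMul (Algebra.adjoin A (Set.range x)) S := inferInstance
  have hD : IsDomain (Algebra.adjoin A (Set.range x)) := inferInstance
  obtain ⟨e⟩ : Nonempty (MvPolynomial ι A ≃ₐ[A] Algebra.adjoin A (Set.range x)) :=
    ⟨hx.1.aevalEquiv⟩
  generalize Algebra.adjoin A (Set.range x) = T at *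
  have hs' : Algebra.adjoin T (s : Set S) = ⊤ := by
    suffices H : ∀ y ∈ Algebra.adjoin A (s : Set S), y ∈ Algebra.adjoin T (s : Set S) from
      Algebra.eq_top_iff.2 fun y => H y (hs ▸ Algebra.mem_top)
    intro y hy
    induction hy using Algebra.adjoin_induction with
    | mem z hz => exact Algebra.subset_adjoin hz
    | algebraMap r =>
      rw [IsScalarTower.algebraMap_apply A T S]
      exact Subalgebra.algebraMap_mem _ _
    | add z w _ _ hz hw => exact add_mem hz hw
    | mul z w _ _ hz hw => exact mul_mem hz hw
  obtain ⟨a, ha, h⟩ := Algebra.IsAlgebraic.exists_map_ne_top s hs'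
  have ha' : e.symm a ≠ 0 := by simpa using ha
  -- Any nonzero coefficient of the polynomial `a` serves as `c`, since membership in the extension
  -- of `q` to the polynomial ring is coefficientwise.
  obtain ⟨m, hm⟩ := MvPolynomial.ne_zero_iff.1 ha'
  refine ⟨_, hm, fun q hq hc => ?_⟩
  have hqT : q.map (algebraMap A T) = (q.map MvPolynomial.C).comap (e.symm : T →+* MvPolynomial ι A) := by
    have : algebraMap A T = (e : MvPolynomial ι A →+* T).comp MvPolynomial.C := by
      ext r : 1
      exact (e.commutes r).symm
    rw [this, ← Ideal.map_map]
    exact Ideal.map_comap_of_equiv (I := q.map MvPolynomial.C) e.toRingEquiv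
  have hC := MvPolynomial.isPrime_map_C (σ := ι) q
  have hp : (q.map (algebraMap A T)).IsPrime := by
    rw [hqT]; exact Ideal.comap_isPrime _ _
  have := h _ hp (by
    rw [hqT, Ideal.mem_comap]
    intro hmem
    exact hc (MvPolynomial.mem_map_C_iff.1 hmem m))
  rwa [Ideal.map_map, ← IsScalarTower.algebraMap_eq] at this

/-! ### Derivations as sections of the dual numbers -/

open scoped Differential

/-- The derivations of a commutative ring into itself. -/
abbrev SelfDerivation (A : Type*) [CommRing A] : Type _ := Derivation ℤ A A

/-- The ring homomorphism `a ↦ g a + g (D a) ε` attached to a derivation `D`. -/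
def Derivation.toDualNumber {A B : Type*} [CommRing A] [CommRing B] (D : SelfDerivation A)
    (g : A →+* B) : A →+* DualNumber B where
  toFun a := TrivSqZeroExt.inl (g a) + TrivSqZeroExt.inr (g (D a))
  map_one' := by ext <;> simp
  map_zero' := by ext <;> simp
  map_add' a b := by ext <;> simp
  map_mul' a b := by
    ext
    · simp
    · simp; ring

/-- The derivation attached to a section `A → A[ε]` of the projection `A[ε] → A`. -/
def Derivation.ofDualNumber {A : Type*} [CommRing A] (f : A →+* DualNumber A)
    (hf : ∀ a, (f a).fst = a) : SelfDerivation A :=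
  Derivation.mk'
    (((TrivSqZeroExt.sndHom A A).toAddMonoidHom.comp f.toAddMonoidHom).toIntLinearMap)
    (fun a b => by simp [hf, mul_comm])

theorem Derivation.ofDualNumber_apply {A : Type*} [CommRing A] (f : A →+* DualNumber A)
    (hf : ∀ a, (f a).fst = a) (a : A) : Derivation.ofDualNumber f hf a = (f a).snd := rfl

section ExtendDeriv

variable {σ R : Type*} [CommRing R] [Differential R]

/-- The ring homomorphism `R → R[σ][ε]` attached to the derivation of `R`. -/
noncomputable def MvPolynomial.coeffDualNumber (σ R : Type*) [CommRing R] [Differential R] :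
    R →+* DualNumber (MvPolynomial σ R) :=
  Derivation.toDualNumber (Differential.deriv : SelfDerivation R) MvPolynomial.C

/-- The derivation of a polynomial ring that extends the derivation of the coefficient ring and
takes the value `v i` at the variable `X i`. -/
noncomputable def MvPolynomial.extendDeriv (v : σ → MvPolynomial σ R) :
    SelfDerivation (MvPolynomial σ R) :=
  Derivation.ofDualNumber
    (MvPolynomial.eval₂Hom (MvPolynomial.coeffDualNumber σ R)
      (fun i => TrivSqZeroExt.inl (MvPolynomial.X i) + TrivSqZeroExt.inr (v i))) (by
    intro p
    induction p using MvPolynomial.induction_on with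
    | C a => simp [MvPolynomial.coeffDualNumber, Derivation.toDualNumber]
    | add p q hp hq => simp only [map_add, TrivSqZeroExt.fst_add, hp, hq]
    | mul_X p i hp => rw [map_mul, TrivSqZeroExt.fst_mul, hp]; simp)

@[simp]
theorem MvPolynomial.extendDeriv_C (v : σ → MvPolynomial σ R) (a : R) :
    MvPolynomial.extendDeriv v (MvPolynomial.C a) = MvPolynomial.C a′ := by
  refine (Derivation.ofDualNumber_apply _ _ _).trans ?_
  simp [MvPolynomial.coeffDualNumber, Derivation.toDualNumber]

@[simp]
theorem MvPolynomial.extendDeriv_X (v : σ → MvPolynomial σ R) (i : σ) :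
    MvPolynomial.extendDeriv v (MvPolynomial.X i) = v i := by
  refine (Derivation.ofDualNumber_apply _ _ _).trans ?_
  simp

theorem MvPolynomial.map_extendDeriv {B : Type*} [CommRing B] [Differential B] [Algebra R B]
    [DifferentialAlgebra R B] (v : σ → MvPolynomial σ R) (φ : MvPolynomial σ R →ₐ[R] B)
    (h : ∀ i, φ (v i) = (φ (MvPolynomial.X i))′) (p : MvPolynomial σ R) :
    φ (MvPolynomial.extendDeriv v p) = (φ p)′ := by
  induction p using MvPolynomial.induction_on with
  | C a =>
    rw [MvPolynomial.extendDeriv_C, ← MvPolynomial.algebraMap_eq, φ.commutes, φ.commutes,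
      deriv_algebraMap]
  | add p q hp hq => simp only [map_add, hp, hq]
  | mul_X p i hp => simp [Derivation.leibniz, hp, h]

end ExtendDeriv

/-! ### Constrained elements from differentially simple algebras -/

namespace DiffField

/-- The derivation of the ring of differential polynomials. -/
noncomputable def DiffPoly.totalDeriv (F : Type u) [Field F] [Differential F] :
    SelfDerivation (DiffPoly F) :=
  MvPolynomial.extendDeriv fun k => MvPolynomial.X (k + 1)

theorem DiffPoly.eval_totalDeriv {F : Type u} [Field F] [Differential F] {E : Type v} [Field E]
    [Differential E] [Algebra F E] [DifferentialAlgebra F E] (η : E) (P : DiffPoly F) :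
    (DiffPoly.totalDeriv F P).eval η = (P.eval η)′ :=
  MvPolynomial.map_extendDeriv _ (MvPolynomial.aeval fun k : ℕ => Differential.deriv^[k] η)
    (fun k => by simp [Function.iterate_succ_apply']) P

/-- The elements of a differentially simple algebra of finite type are constrained. -/
theorem isConstrained_of_mem_simple {G : Type u} [Field G] [Differential G] {H : Type v} [Field H]
    [Differential H] [Algebra G H] [DifferentialAlgebra G H] (S : Subalgebra G H) (hfg : S.FG)
    (hd : ∀ x ∈ S, x′ ∈ S)
    (hs : ∀ J : Ideal S, (∀ x : S, x ∈ J → (⟨(x : H)′, hd x x.2⟩ : S) ∈ J) → J ≠ ⊥ → J = ⊤)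
    {η : H} (hη : η ∈ S) : IsConstrained G η := by
  have hk : ∀ k : ℕ, Differential.deriv^[k] η ∈ S := by
    intro k
    induction k with
    | zero => exact hη
    | succ k ih => rw [Function.iterate_succ_apply']; exact hd _ ih
  let ψ : DiffPoly G →ₐ[G] S := MvPolynomial.aeval fun k => ⟨_, hk k⟩
  have hψ : ∀ P, (ψ P : H) = P.eval η := by
    intro P
    have : S.val.comp ψ = MvPolynomial.aeval fun k : ℕ => Differential.deriv^[k] η := by
      ext k
      simp [ψ]
    exact DFunLike.congr_fun this P
  have hψ0 : ∀ P, ψ P = 0 ↔ P.eval η = 0 := by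
    intro P
    rw [← hψ, ZeroMemClass.coe_eq_zero]
  have : Algebra.FiniteType G S := S.fg_iff_finiteType.1 hfg
  have : Algebra.FiniteType ψ.range S := Algebra.FiniteType.of_restrictScalars_finiteType G _ _
  obtain ⟨c, hc, hcq⟩ := Algebra.FiniteType.exists_map_ne_top ψ.range S
  obtain ⟨C, rfl⟩ := ψ.rangeRestrict_surjective c
  have hC : ψ C ≠ 0 := fun h => hc (Subtype.ext h)
  refine ⟨C, fun h => hC ((hψ0 C).2 h), fun E' _ _ _ _ η' hspec hngen => ?_⟩
  by_contra hCη'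
  refine hngen ⟨hspec, fun P hP => ?_⟩
  -- `P` vanishes at `η'` but not at `η`, so the extended ideal is nonzero; simplicity makes it all
  -- of `S`, against the choice of `C`.
  by_contra hPη
  let φ : DiffPoly G →ₐ[G] E' := MvPolynomial.aeval fun k : ℕ => Differential.deriv^[k] η'
  have hle : RingHom.ker ψ.rangeRestrict ≤ RingHom.ker φ := by
    intro Q hQ
    exact hspec Q ((hψ0 Q).1 (congrArg Subtype.val hQ))
  have : (RingHom.ker φ).IsPrime := RingHom.ker_isPrime φ
  have hprime : (Ideal.map ψ.rangeRestrict (RingHom.ker φ)).IsPrime :=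
    Ideal.map_isPrime_of_surjective ψ.rangeRestrict_surjective hle
  refine hcq _ hprime ?_ ?_
  · intro hmem
    obtain ⟨Q, hQ, hQC⟩ := (Ideal.mem_map_iff_of_surjective _ ψ.rangeRestrict_surjective).1 hmem
    have h1 : C - Q ∈ RingHom.ker φ := hle (by
      rw [RingHom.mem_ker, map_sub, hQC, sub_self])
    have h2 : C ∈ RingHom.ker φ := by simpa using add_mem h1 hQ
    exact hCη' h2
  · have hmap : Ideal.map (algebraMap ψ.range S) (Ideal.map ψ.rangeRestrict (RingHom.ker φ)) =
        Ideal.map ψ (RingHom.ker φ) :=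
      Ideal.map_map ψ.rangeRestrict.toRingHom (algebraMap ψ.range S)
    rw [hmap]
    refine hs _ (fun x hx => ?_) fun hbot => ?_
    · induction hx using Submodule.span_induction with
      | mem x hx =>
        obtain ⟨Q, hQ, rfl⟩ := hx
        have h1 : DiffPoly.totalDeriv G Q ∈ RingHom.ker φ := by
          have h0 : Q.eval η' = 0 := hQ
          have := DiffPoly.eval_totalDeriv η' Q
          rw [h0, map_zero] at this
          exact this
        have h2 := Ideal.mem_map_of_mem ψ h1
        convert h2 using 1
        apply Subtype.ext
        change (ψ Q : H)′ = ψ _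
        rw [hψ, hψ, DiffPoly.eval_totalDeriv]
      | zero =>
        convert Submodule.zero_mem _ using 1
        apply Subtype.ext
        simp
      | add x y _ _ hx hy =>
        convert Submodule.add_mem _ hx hy using 1
        apply Subtype.ext
        simp
      | smul a x hxm hx =>
        convert Submodule.add_mem _ (Ideal.mul_mem_left _ a hx)
          (Ideal.mul_mem_right ⟨(a : H)′, hd a a.2⟩ _ hxm) using 1
        apply Subtype.ext
        simp [Derivation.leibniz]
    · have : ψ P ∈ Ideal.map ψ (RingHom.ker φ) := Ideal.mem_map_of_mem ψ hP
      rw [hbot] at this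
      exact hPη ((hψ0 P).1 this)

end DiffField

/-! ### Derivations of fraction fields -/

theorem Derivation.isUnit_toDualNumber {R : Type*} [CommRing R] [IsDomain R]
    (D : SelfDerivation R) (y : nonZeroDivisors R) :
    IsUnit (D.toDualNumber (algebraMap R (FractionRing R)) y) := by
  rw [TrivSqZeroExt.isUnit_iff_isUnit_fst]
  simp [Derivation.toDualNumber]

/-- The extension of a derivation of a domain to its fraction field. -/
noncomputable def Derivation.fractionRing {R : Type*} [CommRing R] [IsDomain R]
    (D : SelfDerivation R) : SelfDerivation (FractionRing R) :=
  Derivation.ofDualNumber (IsLocalization.lift D.isUnit_toDualNumber) (fun a => by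
    have h : (TrivSqZeroExt.fstHom (FractionRing R) (FractionRing R)
        (FractionRing R)).toRingHom.comp (IsLocalization.lift D.isUnit_toDualNumber) =
          RingHom.id _ := by
      apply IsLocalization.ringHom_ext (nonZeroDivisors R)
      ext r
      simp [Derivation.toDualNumber]
    exact DFunLike.congr_fun h a)

theorem Derivation.fractionRing_algebraMap {R : Type*} [CommRing R] [IsDomain R]
    (D : SelfDerivation R) (r : R) :
    D.fractionRing (algebraMap R (FractionRing R) r) = algebraMap R (FractionRing R) (D r) := by
  refine (Derivation.ofDualNumber_apply _ _ _).trans ?_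
  rw [IsLocalization.lift_eq]
  simp [Derivation.toDualNumber, ← Algebra.algebraMap_eq_smul_one]

/-! ### Prime differential ideals -/

section DifferentialIdeal

variable {R : Type*} [CommRing R] (D : SelfDerivation R)

/-- An ideal is differential if it is stable under the derivation. -/
def Ideal.IsDifferential (I : Ideal R) : Prop := ∀ x ∈ I, D x ∈ I

variable {D}

/-- Differentiating and multiplying by `D x` trades one factor `x` for two factors `D x`, up to an
integer that is invertible over `ℚ`; after `n` rounds, `D x ^ (2 * n)` lies in `I`. -/
theorem Ideal.IsDifferential.radical [Algebra ℚ R] {I : Ideal R} (hI : I.IsDifferential D) :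
    I.radical.IsDifferential D := by
  rintro x ⟨n, hn⟩
  have key : ∀ k ≤ n, x ^ (n - k) * D x ^ (2 * k) ∈ I := by
    intro k
    induction k with
    | zero => intro _; simpa using hn
    | succ k ih =>
      intro hk
      obtain ⟨m, rfl⟩ : ∃ m, n = m + k + 1 := ⟨n - (k + 1), by omega⟩
      have h := ih (by omega)
      have e1 : m + k + 1 - k = m + 1 := by omega
      have e2 : m + k + 1 - (k + 1) = m := by omega
      rw [e1] at h
      rw [e2]
      have h1 : D x * D (x ^ (m + 1) * D x ^ (2 * k)) ∈ I := I.mul_mem_left _ (hI _ h)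
      have h2 : (2 * k : ℕ) • D (D x) * (x ^ (m + 1) * D x ^ (2 * k)) ∈ I := I.mul_mem_left _ h
      have h3 : D x * D (x ^ (m + 1) * D x ^ (2 * k)) =
          (m + 1 : ℕ) • (x ^ m * D x ^ (2 * (k + 1))) +
            (2 * k : ℕ) • D (D x) * (x ^ (m + 1) * D x ^ (2 * k)) := by
        -- The exponent `2 * k - 1` from the Leibniz rule is truncated at `k = 0`.
        rcases k with _ | k
        · simp [Derivation.leibniz_pow]
          ring
        · have e3 : 2 * (k + 1) - 1 = 2 * k + 1 := by omega
          simp only [Derivation.leibniz, Derivation.leibniz_pow, smul_eq_mul, nsmul_eq_mul, e3,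
            Nat.add_sub_cancel]
          push_cast
          ring
      rw [h3] at h1
      have h4 := (Submodule.add_mem_iff_left _ h2).1 h1
      have h5 := Submodule.smul_of_tower_mem I (((m + 1 : ℕ) : ℚ)⁻¹) h4
      rwa [← Nat.cast_smul_eq_nsmul ℚ, smul_smul, inv_mul_cancel₀ (by positivity), one_smul] at h5
  exact ⟨2 * n, by simpa using key n le_rfl⟩

/-- Modulo `x * s`, the square of `D x * s` is a multiple of `D (x * s)`; radicality does the rest.
-/
theorem Ideal.IsDifferential.colon {I : Ideal R} (hI : I.IsDifferential D) (hr : I.IsRadical)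
    (s : R) (x : R) (hx : x * s ∈ I) : D x * s ∈ I := by
  refine hr ⟨2, ?_⟩
  have h1 : x * D s + s * D x ∈ I := by simpa [Derivation.leibniz] using hI _ hx
  have h2 : (D x * s) ^ 2 = (x * D s + s * D x) * (D x * s) - (x * s) * (D s * D x) := by ring
  rw [h2]
  exact sub_mem (I.mul_mem_right _ h1) (I.mul_mem_right _ hx)

/-- The differential ideal `(I : s)` for a radical differential ideal `I`. -/
theorem Ideal.IsDifferential.exists_colon {I : Ideal R} (hI : I.IsDifferential D)
    (hr : I.IsRadical) (s : R) :
    ∃ J : Ideal R, J.IsDifferential D ∧ ∀ x, x ∈ J ↔ x * s ∈ I :=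
  ⟨{ carrier := {x | x * s ∈ I}
     zero_mem' := by simp
     add_mem' := fun {a b} ha hb => by
       simp only [Set.mem_ofPred_eq] at *
       rw [add_mul]; exact I.add_mem ha hb
     smul_mem' := fun c x hx => by
       simp only [Set.mem_ofPred_eq, smul_eq_mul] at *
       rw [mul_assoc]; exact I.mul_mem_left _ hx },
    fun x hx => hI.colon hr s x hx, fun _ => Iff.rfl⟩

/-- In a `ℚ`-algebra, some prime differential ideal is maximal among the differential ideals
without a power of a given non-nilpotent element. -/
theorem Ideal.exists_isPrime_isDifferential_maximal [Algebra ℚ R] (D : SelfDerivation R) {d : R}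
    (hd : ¬ IsNilpotent d) :
    ∃ I : Ideal R, I.IsPrime ∧ I.IsDifferential D ∧ d ∉ I ∧
      ∀ J : Ideal R, J.IsDifferential D → I < J → ∃ N : ℕ, d ^ N ∈ J := by
  let Z : Set (Ideal R) := {I | I.IsDifferential D ∧ ∀ N : ℕ, d ^ N ∉ I}
  obtain ⟨I, -, hI⟩ := zorn_le_nonempty₀ Z (by
    intro c hc hchain y hy
    have hne : c.Nonempty := ⟨y, hy⟩
    have hmem : ∀ x, x ∈ sSup c ↔ ∃ J ∈ c, x ∈ J := fun x =>
      Submodule.mem_sSup_of_directed hne hchain.directedOn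
    refine ⟨sSup c, ⟨fun x hx => ?_, fun N hN => ?_⟩, fun z hz => le_sSup hz⟩
    · obtain ⟨J, hJ, hx⟩ := (hmem x).1 hx
      exact (hmem _).2 ⟨J, hJ, (hc hJ).1 x hx⟩
    · obtain ⟨J, hJ, hx⟩ := (hmem _).1 hN
      exact (hc hJ).2 N hx) ⊥ ⟨fun x hx => by
        rw [Ideal.mem_bot] at hx ⊢; rw [hx, map_zero], fun N hN => hd ⟨N, hN⟩⟩
  obtain ⟨⟨hID, hIN⟩, hmax⟩ := hI
  have hmax' : ∀ J : Ideal R, J.IsDifferential D → I ≤ J → (∀ N : ℕ, d ^ N ∉ J) → J ≤ I :=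
    fun J hJ hle hN => hmax ⟨hJ, hN⟩ hle
  have hrad : I.IsRadical := hmax' _ hID.radical Ideal.le_radical fun N ⟨M, hM⟩ =>
    hIN (N * M) (by rwa [pow_mul])
  have hlt : ∀ J : Ideal R, J.IsDifferential D → I < J → ∃ N : ℕ, d ^ N ∈ J := by
    intro J hJ hlt
    by_contra! h
    exact hlt.not_ge (hmax' J hJ hlt.le h)
  refine ⟨I, ⟨fun h => hIN 0 (by rw [h]; trivial), fun {a b} hab => ?_⟩, hID,
    fun h => hIN 1 (by simpa using h), hlt⟩
  -- For `a * b ∈ I`, the ideal `(I : b)` gains `a`, so it contains some `d ^ N`; then `(I : d ^ N)`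
  -- gains `b`, so it contains some `d ^ M`, and `d ^ (M + N) ∈ I`.
  by_contra! hne
  obtain ⟨ha, hb⟩ := hne
  obtain ⟨J, hJ, hJmem⟩ := hID.exists_colon hrad b
  obtain ⟨N, hN⟩ := hlt J hJ (lt_of_le_of_ne (fun x hx => (hJmem x).2 (I.mul_mem_right _ hx))
    fun h => ha (h ▸ (hJmem a).2 hab))
  obtain ⟨J', hJ', hJmem'⟩ := hID.exists_colon hrad (d ^ N)
  obtain ⟨M, hM⟩ := hlt J' hJ' (lt_of_le_of_ne (fun x hx => (hJmem' x).2 (I.mul_mem_right _ hx))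
    fun h => hb (h ▸ (hJmem' b).2 (by rw [mul_comm]; exact (hJmem _).1 hN)))
  exact hIN (M + N) (by rw [pow_add]; exact (hJmem' _).1 hM)

end DifferentialIdeal

/-! ### Solving differential systems in constrainedly closed fields -/

namespace DiffField

/-- The fraction field of a differential domain of finite type is a constrained extension if every
nonzero differential ideal of the domain contains a power of a fixed nonzero element. -/
theorem isConstrainedExtension_of_maximal {G : Type u} [Field G] [Differential G]
    {R : Type*} [CommRing R] [Algebra G R] [Algebra.FiniteType G R] (D : SelfDerivation R)
    {H : Type v} [Field H] [Differential H] [Algebra G H] [DifferentialAlgebra G H]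
    (θ : R →ₐ[G] H) (hθ : ∀ p, θ (D p) = (θ p)′)
    (hfrac : ∀ h : H, ∃ p b, θ b ≠ 0 ∧ h * θ b = θ p) (d : R) (hd : θ d ≠ 0)
    (hmax : ∀ J : Ideal R, J.IsDifferential D → RingHom.ker θ < J → ∃ N : ℕ, d ^ N ∈ J) :
    IsConstrainedExtension G H := by
  intro η
  obtain ⟨p, b, hb, hη⟩ := hfrac η
  -- Inverting `b` puts `η` into `S`; inverting `d` makes `S` differentially simple.
  set e := θ (b * d) with he
  have he0 : e ≠ 0 := by rw [he, map_mul]; exact mul_ne_zero hb hd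
  let S : Subalgebra G H := θ.range ⊔ Algebra.adjoin G {e⁻¹}
  have hS : S = Algebra.adjoin G (Set.range θ ∪ {e⁻¹}) := by
    rw [Algebra.adjoin_union, ← AlgHom.coe_range, Algebra.adjoin_eq]
  have hθS : ∀ q, θ q ∈ S := fun q => (le_sup_left : θ.range ≤ S) ⟨q, rfl⟩
  have heS : e⁻¹ ∈ S := (le_sup_right : _ ≤ S) (Algebra.self_mem_adjoin_singleton G _)
  have hfg : S.FG := by
    refine Subalgebra.FG.sup ?_ ?_
    · rw [← Algebra.map_top]
      exact (Algebra.FiniteType.out (R := G) (A := R)).map θ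
    · exact ⟨{e⁻¹}, by simp⟩
  have hden : ∀ h ∈ S, ∃ (N : ℕ) (q : R), h * e ^ N = θ q := by
    intro h hh
    rw [hS] at hh
    induction hh using Algebra.adjoin_induction with
    | mem x hx =>
      rcases hx with ⟨q, rfl⟩ | hx
      · exact ⟨0, q, by simp⟩
      · rw [Set.mem_singleton_iff.1 hx]
        exact ⟨1, 1, by simp [he0]⟩
    | algebraMap r => exact ⟨0, algebraMap G R r, by simp⟩
    | add x y _ _ hx hy =>
      obtain ⟨N, q, hq⟩ := hx
      obtain ⟨M, r, hr⟩ := hy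
      refine ⟨N + M, q * (b * d) ^ M + r * (b * d) ^ N, ?_⟩
      rw [map_add, map_mul, map_mul, map_pow, map_pow, ← he, ← hq, ← hr]
      ring
    | mul x y _ _ hx hy =>
      obtain ⟨N, q, hq⟩ := hx
      obtain ⟨M, r, hr⟩ := hy
      refine ⟨N + M, q * r, ?_⟩
      rw [map_mul, ← hq, ← hr]
      ring
  have hder : ∀ x ∈ S, x′ ∈ S := by
    suffices h : ∀ x ∈ Algebra.adjoin G (Set.range θ ∪ {e⁻¹}), x′ ∈ S from
      fun x hx => h x (hS ▸ hx)
    intro x hx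
    induction hx using Algebra.adjoin_induction with
    | mem x hx =>
      rcases hx with ⟨q, rfl⟩ | hx
      · rw [← hθ]; exact hθS _
      · rw [Set.mem_singleton_iff.1 hx, Derivation.leibniz_inv, he, ← hθ, smul_eq_mul]
        exact S.mul_mem (S.neg_mem (S.pow_mem heS 2)) (hθS _)
    | algebraMap r => rw [deriv_algebraMap]; exact S.algebraMap_mem _
    | add x y hxm hym hx hy =>
      rw [map_add]
      rw [← hS] at hxm hym
      exact S.add_mem hx hy
    | mul x y hxm hym hx hy =>
      rw [← hS] at hxm hym
      rw [Derivation.leibniz]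
      exact S.add_mem (S.mul_mem hxm hy) (S.mul_mem hym hx)
  refine isConstrained_of_mem_simple S hfg hder (fun J hJ hne => ?_) (η := η) ?_
  · let θS : R →ₐ[G] S := θ.codRestrict S hθS
    obtain ⟨N, hN⟩ := hmax (J.comap θS) (fun x hx => by
        have h := hJ _ hx
        rw [Ideal.mem_comap]
        convert h using 1
        exact Subtype.ext (hθ x)) (by
      -- A nonzero element of `J`, cleared of its denominator `e ^ N`, comes from an element of `R`
      -- outside the kernel.
      refine lt_of_le_of_ne (fun x hx => ?_) fun h => hne ?_
      · have : θS x = 0 := Subtype.ext hx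
        rw [Ideal.mem_comap, this]
        exact J.zero_mem
      · rw [eq_bot_iff]
        intro x hx
        obtain ⟨N, q, hq⟩ := hden x x.2
        have hqJ : q ∈ J.comap θS := by
          have h1 : θS q = x * (θS (b * d)) ^ N := Subtype.ext hq.symm
          rw [Ideal.mem_comap, h1]
          exact J.mul_mem_right _ hx
        rw [← h] at hqJ
        have h2 : (x : H) * e ^ N = 0 := hq.trans hqJ
        exact Subtype.ext ((mul_eq_zero.1 h2).resolve_right (pow_ne_zero _ he0)))
    rw [Ideal.eq_top_iff_one]
    have h1 := J.mul_mem_left ((θS b * ⟨e⁻¹, heS⟩) ^ N) (Ideal.mem_comap.1 hN)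
    convert h1 using 1
    apply Subtype.ext
    rw [map_pow, ← mul_pow]
    change 1 = (θ b * e⁻¹ * θ d) ^ N
    have : θ b * e⁻¹ * θ d = 1 := by
      rw [mul_right_comm, ← map_mul, ← he, mul_inv_cancel₀ he0]
    rw [this, one_pow]
  · have : η = θ (p * d) * e⁻¹ := by
      rw [eq_mul_inv_iff_mul_eq₀ he0, he, map_mul, map_mul, ← mul_assoc, hη]
    rw [this]
    exact S.mul_mem (hθS _) heS

/-- A first-order polynomial differential system has a solution in a constrainedly closed field of
characteristic zero, subject to any nonzero polynomial inequation. -/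
theorem IsConstrainedlyClosed.exists_solution {G : Type u} [Field G] [Differential G] [CharZero G]
    (hG : IsConstrainedlyClosed G) {σ : Type} [Finite σ] (v : σ → MvPolynomial σ G)
    (d : MvPolynomial σ G) (hd : d ≠ 0) :
    ∃ g : σ → G, (∀ i, (g i)′ = MvPolynomial.aeval g (v i)) ∧ MvPolynomial.aeval g d ≠ 0 := by
  let D : SelfDerivation (MvPolynomial σ G) := MvPolynomial.extendDeriv v
  obtain ⟨I, hI, hID, hdI, hmax⟩ := Ideal.exists_isPrime_isDifferential_maximal D
    (d := d) (by rwa [isNilpotent_iff_eq_zero])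
  let R := MvPolynomial σ G ⧸ I
  have hDI : ∀ x, Ideal.Quotient.mkₐ ℤ I x = 0 → Ideal.Quotient.mkₐ ℤ I (D x) = 0 := fun x hx =>
    Ideal.Quotient.eq_zero_iff_mem.2 (hID x (Ideal.Quotient.eq_zero_iff_mem.1 hx))
  let DR : SelfDerivation R :=
    Derivation.liftOfSurjective (Ideal.Quotient.mkₐ_surjective ℤ I) hDI
  have hDR : ∀ x, DR (Ideal.Quotient.mk I x) = Ideal.Quotient.mk I (D x) := fun x =>
    Derivation.liftOfSurjective_apply (Ideal.Quotient.mkₐ_surjective ℤ I) hDI x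
  let H := FractionRing R
  let _ : Differential H := ⟨DR.fractionRing⟩
  let θ : MvPolynomial σ G →ₐ[G] H := (Algebra.ofId R H |>.restrictScalars G).comp
    (Ideal.Quotient.mkₐ G I)
  have hθ : ∀ p, θ (D p) = (θ p)′ := fun p =>
    ((DR.fractionRing_algebraMap _).trans (congrArg _ (hDR p))).symm
  have hker : RingHom.ker θ = I := by
    ext x
    rw [RingHom.mem_ker]
    change algebraMap R H (Ideal.Quotient.mk I x) = 0 ↔ _
    rw [FaithfulSMul.algebraMap_eq_zero_iff, Ideal.Quotient.eq_zero_iff_mem]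
  have : DifferentialAlgebra G H := ⟨fun a => by
    rw [← θ.commutes, ← hθ, ← θ.commutes, MvPolynomial.algebraMap_eq]
    exact congrArg θ (MvPolynomial.extendDeriv_C v a)⟩
  have hθd : θ d ≠ 0 := fun h => hdI (hker ▸ h)
  have hcon : IsConstrainedExtension G H := by
    refine isConstrainedExtension_of_maximal D θ hθ (fun h => ?_) d hθd (fun J hJ hlt => ?_)
    · obtain ⟨p, b, hb, rfl⟩ := IsFractionRing.div_surjective (A := R) h
      obtain ⟨p, rfl⟩ := Ideal.Quotient.mk_surjective p
      obtain ⟨b, rfl⟩ := Ideal.Quotient.mk_surjective b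
      have hb0 : algebraMap R H (Ideal.Quotient.mk I b) ≠ 0 :=
        IsFractionRing.to_map_ne_zero_of_mem_nonZeroDivisors hb
      exact ⟨p, b, hb0, div_mul_cancel₀ _ hb0⟩
    · exact hmax J hJ (hker ▸ hlt)
  -- `H` is now `G` itself, so the images of the variables are a solution in `G`.
  have hsurj := hG H hcon
  choose g hg using fun i => hsurj (θ (MvPolynomial.X i))
  have hinj := (algebraMap G H).injective
  have hθg : ∀ p, θ p = algebraMap G H (MvPolynomial.aeval g p) := by
    intro p
    have : θ = (Algebra.ofId G H).comp (MvPolynomial.aeval g) := by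
      ext i
      simp [Algebra.ofId_apply, hg]
    rw [this]
    rfl
  refine ⟨g, fun i => hinj ?_, fun h => hθd ?_⟩
  · rw [← deriv_algebraMap, hg, ← hθ, ← hθg]
    exact congrArg θ (MvPolynomial.extendDeriv_X v i)
  · rw [hθg, h, map_zero]

/-! ### Linear equations and the Wronskian -/

/-- A homogeneous linear differential polynomial has a fundamental system of solutions in a
constrainedly closed field of characteristic zero. -/
theorem IsConstrainedlyClosed.exists_fundamental_system {G : Type u} [Field G] [Differential G]
    [CharZero G] (hG : IsConstrainedlyClosed G) (n : ℕ) (a : ℕ → G) (ha : a n ≠ 0) :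
    ∃ y : Fin n → G,
      (∀ j, ∑ k ∈ Finset.range (n + 1), a k * Differential.deriv^[k] (y j) = 0) ∧
        LinearIndependent (constants G) y := by
  obtain _ | m := n
  · exact ⟨Fin.elim0, fun j => j.elim0, linearIndependent_empty_type⟩
  -- Companion system: the variable `(i, j)` plays the `i`-th derivative of the `j`-th solution, and
  -- the equation, solved for its top derivative, closes the last row.
  let v : Fin (m + 1) × Fin (m + 1) → MvPolynomial (Fin (m + 1) × Fin (m + 1)) G := fun p =>
    if h : p.1.1 + 1 < m + 1 then MvPolynomial.X (⟨p.1.1 + 1, h⟩, p.2)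
    else ∑ k : Fin (m + 1), MvPolynomial.C (-(a k / a (m + 1))) * MvPolynomial.X (k, p.2)
  obtain ⟨g, hg, hdet⟩ := hG.exists_solution v _
    (Matrix.det_mvPolynomialX_ne_zero (Fin (m + 1)) G)
  have hiter : ∀ (j : Fin (m + 1)) (k : ℕ) (hk : k < m + 1),
      Differential.deriv^[k] (g (0, j)) = g (⟨k, hk⟩, j) := by
    intro j k
    induction k with
    | zero => intro _; rfl
    | succ k ih =>
      intro hk
      rw [Function.iterate_succ_apply', ih (by omega), hg]
      simp [v, Nat.lt_of_succ_lt_succ hk]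
  refine ⟨fun j => g (0, j), fun j => ?_, ?_⟩
  · have hlast : Differential.deriv^[m + 1] (g (0, j)) =
        ∑ k : Fin (m + 1), -(a k / a (m + 1)) * g (k, j) := by
      rw [Function.iterate_succ_apply', hiter j m (by omega), hg]
      simp [v]
    rw [Finset.sum_range_succ, hlast, Finset.sum_range, Finset.mul_sum, ← Finset.sum_add_distrib]
    refine Finset.sum_eq_zero fun k _ => ?_
    rw [hiter j k k.2]
    field_simp
    ring
  · rw [Fintype.linearIndependent_iff]
    intro c hc
    -- Constants pass through derivations, so the relation persists for all derivatives and its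
    -- coefficient vector is killed by the Wronskian matrix.
    have hk : ∀ (k : ℕ), ∑ j, (c j : G) * Differential.deriv^[k] (g (0, j)) = 0 := by
      intro k
      induction k with
      | zero => exact hc
      | succ k ih =>
        have h := congrArg (Differential.deriv : SelfDerivation G) ih
        rw [map_sum, map_zero] at h
        rw [← h]
        refine Finset.sum_congr rfl fun j _ => ?_
        have hcj : (c j : G)′ = 0 := (c j).2
        rw [Derivation.leibniz, hcj, smul_zero, add_zero, Function.iterate_succ_apply',
          smul_eq_mul]
    have hM : (Matrix.of fun i j => g (i, j)).det ≠ 0 := by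
      rw [Matrix.mvPolynomialX, AlgHom.map_det] at hdet
      convert hdet using 2
      ext i j
      simp
    have h0 := Matrix.eq_zero_of_mulVec_eq_zero hM (v := fun j => (c j : G)) (by
      ext i
      have h := hk i
      simp only [hiter _ _ i.2] at h
      simpa [Matrix.mulVec, dotProduct, mul_comm] using h)
    exact fun j => Subtype.ext (congrFun h0 j)

/-- The monomials of a homogeneous linear differential polynomial are derivatives of the
indeterminate. -/
theorem DiffPoly.IsHomogeneousLinear.exists_eq_single {F : Type u} [Field F] {P : DiffPoly F}
    (hlin : P.IsHomogeneousLinear) {m : ℕ →₀ ℕ} (hm : MvPolynomial.coeff m P ≠ 0) :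
    ∃ k, m = Finsupp.single k 1 := by
  refine (Finsupp.sum_eq_one_iff m).1 ?_
  change m.degree = 1
  rw [Finsupp.degree_eq_weight_one]
  exact hlin hm

/-- A homogeneous linear differential polynomial of order `n` is the combination of the first
`n + 1` derivatives of the indeterminate given by its coefficients. -/
theorem DiffPoly.IsHomogeneousLinear.eq_sum {F : Type u} [Field F] {P : DiffPoly F}
    (hlin : P.IsHomogeneousLinear) {n : ℕ} (hord : P.HasOrder n) :
    P = ∑ k ∈ Finset.range (n + 1),
      MvPolynomial.C (P.coeff (Finsupp.single k 1)) * MvPolynomial.X k := by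
  ext m
  simp only [MvPolynomial.coeff_sum, MvPolynomial.coeff_C_mul, MvPolynomial.coeff_X]
  by_cases hm : MvPolynomial.coeff m P = 0
  · rw [hm]
    symm
    refine Finset.sum_eq_zero fun k _ => ?_
    split_ifs with h
    · rw [h, hm, zero_mul]
    · rw [mul_zero]
  · obtain ⟨k, rfl⟩ := hlin.exists_eq_single hm
    have hk : k ≤ n := hord.2 ((MvPolynomial.mem_vars_iff_mem_support k).2
      ⟨_, MvPolynomial.mem_support_iff.2 hm, by simp⟩)
    rw [Finset.sum_eq_single k]
    · simp
    · intro j _ hj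
      rw [if_neg, mul_zero]
      intro h
      exact hj (Finsupp.single_left_injective one_ne_zero h)
    · intro h
      exact absurd (Finset.mem_range.2 (by omega)) h

theorem DiffPoly.IsHomogeneousLinear.coeff_ne_zero {F : Type u} [Field F] {P : DiffPoly F}
    (hlin : P.IsHomogeneousLinear) {n : ℕ} (hord : P.HasOrder n) :
    P.coeff (Finsupp.single n 1) ≠ 0 := by
  obtain ⟨m, hm, hn⟩ := (MvPolynomial.mem_vars_iff_mem_support n).1 hord.1
  have hm' := MvPolynomial.mem_support_iff.1 hm
  obtain ⟨k, rfl⟩ := hlin.exists_eq_single hm'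
  have : n = k := by
    by_contra h
    exact h (by simpa using hn)
  rwa [this]

end DiffField

theorem IsFormallyReal.charZero (K : Type*) [Field K] [IsFormallyReal K] : CharZero K := by
  refine charZero_of_inj_zero fun n hn => ?_
  by_contra h
  obtain ⟨m, rfl⟩ := Nat.exists_eq_succ_of_ne_zero h
  have : ∀ k : ℕ, IsSumNonzeroSq ((k + 1 : ℕ) : K) := by
    intro k
    induction k with
    | zero => simpa using IsSumNonzeroSq.sq (one_ne_zero : (1 : K) ≠ 0)
    | succ k ih =>
      have := IsSumNonzeroSq.sq_add (one_ne_zero : (1 : K) ≠ 0) ih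
      rwa [one_mul, ← Nat.cast_one, ← Nat.cast_add, add_comm] at this
  exact IsFormallyReal.not_isSumNonzeroSq_zero (hn ▸ this m)

theorem mainTheorem3 {F : Type u} [Field F] [Differential F] (K : Subfield F)
    {G : Type v} [Field G] [Differential G] [Algebra F G] [DifferentialAlgebra F G]
    (L : Subfield G)
    (hFK : DiffField.IsRealType K)
    (hGL : DiffField.IsRealTypeExtension K L)
    (hclosed : DiffField.IsConstrainedlyClosed G)
    (hconstrained : DiffField.IsConstrainedExtension F G)
    (n : ℕ) (ℒ : DiffField.DiffPoly F)
    (hlin : ℒ.IsHomogeneousLinear) (hord : ℒ.HasOrder n) :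
    ∃ y : Fin n → G, (∀ j, ℒ.eval (y j) = 0) ∧
      LinearIndependent (DiffField.constants G) y := by
  -- Formal reality supplies characteristic zero, on which the division in
  -- `Ideal.IsDifferential.radical` depends.
  have := hGL.realType.formallyReal
  have := IsFormallyReal.charZero L
  have : CharZero G := (RingHom.charZero_iff L.subtype.injective).1 this
  obtain ⟨y, hy, hli⟩ := hclosed.exists_fundamental_system n
    (fun k => algebraMap F G (ℒ.coeff (Finsupp.single k 1)))
    ((map_ne_zero _).2 (hlin.coeff_ne_zero hord))
  refine ⟨y, fun j => ?_, hli⟩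
  rw [hlin.eq_sum hord, DiffField.DiffPoly.eval, map_sum, ← hy j]
  exact Finset.sum_congr rfl fun k _ => by simp
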